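/- Let $1_S\in\mathbb R^d$ be the indicator vector of $S\subseteq[d]=\{1,\dots,d\}$, and for $0\le k\le d$ and $\mu\in\mathbb R$ consider the $k$-sets family $\mathcal V_{d,k,\mu}=\{\mu 1_S : S\subseteq[d],\ |S|=k\}$. An estimator is a measurable map $T$ from $\mathbb R^d$ to the set of $k$-subsets of $[d]$. In the isotropic setting $\mathbb P_S=\mathcal N(\mu 1_S,I_d)$ and the minimax risk is $\mathcal R(\mathcal V)=\inf_T\sup_S\mathbb P_S[T(y)\ne S]$. In the experimental design setting, for $B\in\mathbb R_{\ge0}^d$ let $\mathbb P_{S,B}$ be the law of a vector $y$ with independent coordinates, $y(i)\sim\mathcal N(\mu 1_S(i),B(i)^{-1})$ if $B(i)>0$ and $y(i)=0$ almost surely if $B(i)=0$; the minimax risk with budget $\tau$ is $\mathcal R(\mathcal V,\tau)=\inf_{T,\,B:\|B\|_1\le\tau}\sup_S\mathbb P_{S,B}[T(y)\ne S]$. A maximum likelihood estimator (MLE) is any measurable selection of $\arg\min_S\|\mu1_S-y\|_2^2$, respectively, under strategy $B$, of $\arg\min_S\sum_iB(i)(\mu1_S(i)-y(i))^2$; such selections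 exist. For a sequence of problems, "the minimax rate is $\mu\asymp f(n)$" means: for every sequence $\mu_n$, if $f(n)=o(\mu_n)$ then the minimax risk of the $n$-th problem at $\mu=\mu_n$ tends to $0$, and if $\mu_n=o(f(n))$ then it tends to $1$. 1. Let $d_n\to\infty$ and $1\le k_n<d_n$. The minimax rate of $\mathcal R(\mathcal V_{d_n,k_n,\mu})$ is $\mu\asymp\sqrt{\log(k_n(d_n-k_n))}$. 2. For every sequence of budgets $\tau_n>0$, the minimax rate of $\mathcal R(\mathcal V_{d_n,k_n,\mu},\tau_n)$ is $\mu\asymp\sqrt{\tfrac{d_n}{\tau_n}\log(k_n(d_n-k_n))}$. Uniform sampling $\hat B(i)=\tau/d$ is optimal in the following two senses. (a) If $\sqrt{\tfrac{d_n}{\tau_n}\log(k_n(d_n-k_n))}=o(\mu_n)$, then the maximum risk of every MLE under uniform sampling with budget $\tau_n$ tends to $0$. (b) For all $0\le k\le d$, $\mu\in\mathbb R$, $\alpha>0$ and $\tau\ge0$, uniform sampling minimizes $$W(\mathcal V,\alpha,B)=\max_S\sum_{S'\ne S}\exp\Bigl(-\tfrac1\alpha\sum_iB(i)\,\mu^2(1_S(i)-1_{S'}(i))^2\Bigr)$$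 over all $B\in\mathbb R_{\ge0}^d$ with $\|B\|_1\le\tau$. 3. In the isotropic setting, for all $0\le k\le d$ and $\mu\ne0$, every MLE $T$ is exactly minimax optimal: $\sup_S\mathbb P_S[T(y)\ne S]=\mathcal R(\mathcal V_{d,k,\mu})$. -/

import Mathlib

open MeasureTheory ProbabilityTheory Filter Topology Asymptotics
open scoped NNReal ENNReal

namespace NormalMeans

noncomputable section

/-- The law `N(v, I_d)` of an isotropic Gaussian vector with mean `v`. -/
def isoLaw {d : ℕ} (v : Fin d → ℝ) : Measure (Fin d → ℝ) :=
  Measure.pi fun i => gaussianReal (v i) 1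

/-- The law of the observation under the sensing strategy `B`: independent coordinates,
`y i ∼ N(v i, (B i)⁻¹)` if `B i > 0`, and `y i = 0` almost surely if `B i = 0`. -/
def designLaw {d : ℕ} (v : Fin d → ℝ) (B : Fin d → ℝ≥0) : Measure (Fin d → ℝ) :=
  Measure.pi fun i => if B i = 0 then Measure.dirac 0 else gaussianReal (v i) (B i)⁻¹

/-- An estimator is a measurable map into the (discrete) set of hypotheses. -/
def IsEstimator {d : ℕ} {ι : Type} (T : (Fin d → ℝ) → ι) : Prop :=
  @Measurable _ _ _ ⊤ T

/-- The maximum risk `sup_j P_j[T(y) ≠ j]`. -/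
def maxRisk {d : ℕ} {ι : Type} (P : ι → Measure (Fin d → ℝ)) (T : (Fin d → ℝ) → ι) : ℝ≥0∞ :=
  ⨆ j, P j {y | T y ≠ j}

/-- The minimax risk `inf_T sup_j P_j[T(y) ≠ j]` of a family of laws. -/
def lawMinimaxRisk {d : ℕ} {ι : Type} (P : ι → Measure (Fin d → ℝ)) : ℝ≥0∞ :=
  ⨅ (T : (Fin d → ℝ) → ι) (_ : IsEstimator T), maxRisk P T

/-- The minimax risk in the isotropic setting. -/
def minimaxRisk {d : ℕ} {ι : Type} (v : ι → Fin d → ℝ) : ℝ≥0∞ :=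
  lawMinimaxRisk fun j => isoLaw (v j)

/-- The minimax risk in the experimental design setting with budget `τ`: the infimum is over
the estimator and over all strategies `B ≥ 0` with `‖B‖₁ ≤ τ`. -/
def budgetMinimaxRisk {d : ℕ} {ι : Type} (v : ι → Fin d → ℝ) (τ : ℝ≥0) : ℝ≥0∞ :=
  ⨅ (B : Fin d → ℝ≥0) (_ : ∑ i, B i ≤ τ), lawMinimaxRisk fun j => designLaw (v j) B

/-- `T` is a maximum likelihood estimator in the isotropic setting, i.e. a measurable selection
of `argmin_j ‖v_j - y‖₂²` (with any rule for breaking ties). -/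
def IsMLE {d : ℕ} {ι : Type} (v : ι → Fin d → ℝ) (T : (Fin d → ℝ) → ι) : Prop :=
  IsEstimator T ∧ ∀ y j, ∑ i, (v (T y) i - y i) ^ 2 ≤ ∑ i, (v j i - y i) ^ 2

/-- `T` is a maximum likelihood estimator under the strategy `B`, i.e. a measurable selection
of `argmin_j ‖v_j - y‖_B²`. -/
def IsDesignMLE {d : ℕ} {ι : Type} (v : ι → Fin d → ℝ) (B : Fin d → ℝ≥0)
    (T : (Fin d → ℝ) → ι) : Prop :=
  IsEstimator T ∧
    ∀ y j, ∑ i, (B i : ℝ) * (v (T y) i - y i) ^ 2 ≤ ∑ i, (B i : ℝ) * (v j i - y i) ^ 2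

/-- The sampling exponentiated distance function
`W(V, α, B) = max_j ∑_{l ≠ j} exp(-‖v_j - v_l‖_B² / α)`. -/
def sedf {d : ℕ} {ι : Type} [Fintype ι] [DecidableEq ι] (v : ι → Fin d → ℝ) (α : ℝ)
    (B : Fin d → ℝ≥0) : ℝ :=
  ⨆ j, ∑ l with l ≠ j, Real.exp (-(∑ i, (B i : ℝ) * (v j i - v l i) ^ 2) / α)

/-- The uniform sampling strategy with budget `τ`. -/
def uniformDesign (d : ℕ) (τ : ℝ≥0) : Fin d → ℝ≥0 := fun _ => τ / d

/-- The `k`-subsets of `{1, …, d}`. -/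
abbrev KSubset (d k : ℕ) : Type := {S : Finset (Fin d) // S.card = k}

/-- The `k`-sets family: the vectors `μ 1_S` with `|S| = k`. -/
def kSets (d k : ℕ) (μ : ℝ) (S : KSubset d k) : Fin d → ℝ :=
  fun i => if i ∈ S.1 then μ else 0

/-- `μ ≍ f(n)` is the minimax rate for a sequence of problems with risks `R n μ`: if
`μ = ω(1) f(n)` then the risk tends to zero, and if `μ = o(1) f(n)` then it tends to one. -/
def IsMinimaxRate (R : ℕ → ℝ → ℝ≥0∞) (f : ℕ → ℝ) : Prop :=
  ∀ μ : ℕ → ℝ,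
    (f =o[atTop] μ → Tendsto (fun n => R n (μ n)) atTop (𝓝 0)) ∧
    (μ =o[atTop] f → Tendsto (fun n => R n (μ n)) atTop (𝓝 1))

end

end NormalMeans

/-! Write `‖u‖_B² = ∑ i, B i * u i ^ 2`. Under `B` the observations with means `v` and `w` have an
explicit likelihood ratio, whose second moment under `w` is `exp ‖v - w‖_B²`.

*Upper bound.* By Chernoff's inequality a given wrong hypothesis `v'` fits better than the true `v`
with probability at most `exp (-‖v - v'‖_B² / 8)`, so the MLE has risk at most `W(V, 8, B)`. For the
`k`-sets and constant `B = b` this is at most `(1 + exp (-b μ² / 8)) ^ d - 1`.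

*Lower bound.* If `B` has budget `τ`, then at least three quarters of the coordinates have effort at
most `4 τ / d`. For a suitable `A` of size `k - 1` or `k + 1` (according to whether `2 k ≤ d`), at
least `d / 4` of these coordinates `c` make `A ∆ {c}` a `k`-set. All these hypotheses are at
squared distance `‖·‖_B²` at most `4 μ² τ / d` from `μ 1_A`, and by Cauchy-Schwarz no estimator
can separate them unless `exp (4 μ² τ / d)` is of order `d`. Both bounds match since
`log (k (d - k))` and `log d` are comparable.

*Symmetry.* `W(V, α, ·)` is convex, decreasing and, for the `k`-sets, invariant under cyclic shifts;
averaging over the shifts makes any strategy uniform. The MLE is Bayes optimal for the uniform prior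
and, two MLEs being almost surely equal, its error probability is invariant under the symmetries of
the family; when these act transitively it is an equalizer rule, hence minimax.
-/

namespace NormalMeans

open scoped symmDiff Finset

section Density

variable {α : Type*} [MeasurableSpace α]

theorem pi_withDensity {ι : Type*} [Fintype ι] {X : ι → Type*} [∀ i, MeasurableSpace (X i)]
    (μ : ∀ i, Measure (X i)) [∀ i, IsProbabilityMeasure (μ i)] {f : ∀ i, X i → ℝ≥0∞}
    (hf : ∀ i, Measurable (f i)) [∀ i, SigmaFinite ((μ i).withDensity (f i))] :
    Measure.pi (fun i => (μ i).withDensity (f i)) =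
      (Measure.pi μ).withDensity fun x => ∏ i, f i (x i) := by
  refine Measure.pi_eq fun s hs => ?_
  have hfs : ∀ i, Measurable ((s i).indicator (f i)) := fun i => (hf i).indicator (hs i)
  have hprod : (Set.univ.pi s).indicator (fun x : ∀ i, X i => ∏ i, f i (x i)) =
      fun x => ∏ i, (s i).indicator (f i) (x i) := by
    classical
    ext x
    simp only [Set.indicator_apply, Set.mem_univ_pi, Finset.prod_ite_zero, Finset.mem_univ,
      true_imp_iff]
  calc (Measure.pi μ).withDensity (fun x => ∏ i, f i (x i)) (Set.univ.pi s)
      = ∫⁻ x, ∏ i, (s i).indicator (f i) (x i) ∂Measure.pi μ := by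
        rw [withDensity_apply _ (.univ_pi hs), ← lintegral_indicator (.univ_pi hs), hprod]
    _ = ∏ i, ∫⁻ x, (s i).indicator (f i) (x i) ∂Measure.pi μ :=
        lintegral_prod_eq_prod_lintegral_of_indepFun _ _
          (iIndepFun_pi fun i => (hfs i).aemeasurable)
          fun i => (hfs i).comp (measurable_pi_apply i)
    _ = ∏ i, (μ i).withDensity (f i) (s i) := Finset.prod_congr rfl fun i _ => by
        rw [(measurePreserving_eval μ i).lintegral_comp (hfs i), lintegral_indicator (hs i),
          withDensity_apply _ (hs i)]

theorem withDensity_apply_le_rpow_mul_rpow (μ : Measure α) {f : α → ℝ≥0∞} (hf : Measurable f)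
    {A : Set α} (hA : MeasurableSet A) :
    μ.withDensity f A ≤ μ A ^ (1 / 2 : ℝ) * (∫⁻ x, f x ^ 2 ∂μ) ^ (1 / 2 : ℝ) := by
  have hölder := ENNReal.lintegral_mul_le_Lp_mul_Lq (μ.restrict A) .two_two
    (aemeasurable_const (b := 1)) hf.aemeasurable
  simp only [Pi.mul_apply, one_mul, ENNReal.rpow_ofNat, one_pow, lintegral_one,
    Measure.restrict_apply_univ] at hölder
  rw [withDensity_apply _ hA]
  refine hölder.trans ?_
  gcongr
  exact Measure.restrict_le_self

theorem sum_withDensity_eq_lintegral {ι : Type*} [Fintype ι] (μ : Measure α) {L : ι → α → ℝ≥0∞}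
    (hL : ∀ j, Measurable (L j)) {U : α → ι} (hU : ∀ j, MeasurableSet {x | U x = j}) :
    ∑ j, μ.withDensity (L j) {x | U x = j} = ∫⁻ x, L (U x) x ∂μ := by
  classical
  have hpartition : ∀ x, ∑ j, {x | U x = j}.indicator (L j) x = L (U x) x := fun x => by
    simp [Set.indicator_apply]
  simp_rw [← hpartition]
  rw [lintegral_finsetSum _ fun j _ => (hL j).indicator (hU j)]
  exact Finset.sum_congr rfl fun j _ => by
    rw [withDensity_apply _ (hU j), lintegral_indicator (hU j)]

theorem pi_hyperplane_eq_zero {d : ℕ} (μ : Fin d → Measure ℝ) [∀ i, SigmaFinite (μ i)]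
    {a : Fin d → ℝ} {i : Fin d} [NullSingletonClass (μ i)] (hi : a i ≠ 0) (c : ℝ) :
    Measure.pi μ {y | ∑ j, a j * y j = c} = 0 := by
  obtain _ | n := d
  · exact i.elim0
  have hmeas : MeasurableSet {p : ℝ × (Fin n → ℝ) |
      a i * p.1 + ∑ j, a (i.succAbove j) * p.2 j = c} :=
    measurableSet_eq_fun (by fun_prop) measurable_const
  have hsection (z : Fin n → ℝ) : μ i {t | a i * t + ∑ j, a (i.succAbove j) * z j = c} = 0 := by
    refine Set.Subsingleton.measure_zero (fun s hs t ht => ?_) _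
    exact mul_left_cancel₀ hi (add_right_cancel (hs.trans ht.symm))
  have hsplit : {y : Fin (n + 1) → ℝ | ∑ j, a j * y j = c} =
      MeasurableEquiv.piFinSuccAbove (fun _ => ℝ) i ⁻¹'
        {p | a i * p.1 + ∑ j, a (i.succAbove j) * p.2 j = c} := by
    ext y
    simp only [Set.mem_ofPred_eq, Set.mem_preimage, MeasurableEquiv.piFinSuccAbove_apply,
      Fin.insertNthEquiv_symm_apply, Fin.sum_univ_succAbove _ i, Fin.removeNth]
  rw [hsplit, (measurePreserving_piFinSuccAbove μ i).measure_preimage hmeas.nullMeasurableSet,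
    Measure.prod_apply_symm hmeas]
  exact (lintegral_congr hsection).trans lintegral_zero

end Density

section DesignLaw

/-- The law of a single coordinate of the observation, with mean `m` and sampling effort `b`. -/
noncomputable def coordLaw (m : ℝ) (b : ℝ≥0) : Measure ℝ :=
  if b = 0 then Measure.dirac 0 else gaussianReal m b⁻¹

instance (m : ℝ) (b : ℝ≥0) : IsProbabilityMeasure (coordLaw m b) := by
  unfold coordLaw; split_ifs <;> infer_instance

theorem nullSingletonClass_coordLaw (m : ℝ) {b : ℝ≥0} (hb : b ≠ 0) :
    NullSingletonClass (coordLaw m b) := by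
  rw [coordLaw, if_neg hb]
  exact nullSingletonClass_gaussianReal (inv_ne_zero hb)

theorem coordLaw_add (m u : ℝ) (b : ℝ≥0) :
    coordLaw (m + u) b = (coordLaw m b).withDensity
      fun x => ENNReal.ofReal (Real.exp (b * (u * (x - m) - u ^ 2 / 2))) := by
  unfold coordLaw
  split_ifs with hb
  · simp [hb, withDensity_const]
  have hbR : (b : ℝ) ≠ 0 := by exact_mod_cast hb
  rw [gaussianReal_of_var_ne_zero _ (inv_ne_zero hb),
    gaussianReal_of_var_ne_zero _ (inv_ne_zero hb),
    ← withDensity_mul _ (measurable_gaussianPDF _ _) (by fun_prop)]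
  congr with x
  simp only [Pi.mul_apply, gaussianPDF]
  rw [← ENNReal.ofReal_mul (gaussianPDFReal_nonneg _ _ _)]
  simp only [gaussianPDFReal, NNReal.coe_inv]
  rw [mul_assoc _ (Real.exp _), ← Real.exp_add]
  congr 3
  field_simp
  ring

variable {d : ℕ}

theorem designLaw_eq_pi_coordLaw (v : Fin d → ℝ) (B : Fin d → ℝ≥0) :
    designLaw v B = Measure.pi fun i => coordLaw (v i) (B i) := rfl

instance (v : Fin d → ℝ) (B : Fin d → ℝ≥0) : IsProbabilityMeasure (designLaw v B) := by
  rw [designLaw_eq_pi_coordLaw]; infer_instance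

theorem isoLaw_eq_designLaw_one (v : Fin d → ℝ) : isoLaw v = designLaw v 1 := by
  simp [isoLaw, designLaw]

theorem measurePreserving_comp_perm (v : Fin d → ℝ) (B : Fin d → ℝ≥0)
    (σ : Equiv.Perm (Fin d)) :
    MeasurePreserving (· ∘ σ) (designLaw v B) (designLaw (v ∘ σ) (B ∘ σ)) :=
  measurePreserving_arrowCongr' (fun i => coordLaw (v i) (B i))
    (fun i => coordLaw (v (σ i)) (B (σ i))) σ.symm (MeasurableEquiv.refl ℝ) fun i => by
      rw [Equiv.apply_symm_apply]; exact .id _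

/-- The likelihood ratio at `y` between the means `w + u` and `w` under the strategy `B`. -/
noncomputable def likelihoodRatio (B : Fin d → ℝ≥0) (w u y : Fin d → ℝ) : ℝ≥0∞ :=
  ENNReal.ofReal (Real.exp (∑ i, (B i : ℝ) * (u i * (y i - w i) - u i ^ 2 / 2)))

@[fun_prop]
theorem measurable_likelihoodRatio (B : Fin d → ℝ≥0) (w u : Fin d → ℝ) :
    Measurable (likelihoodRatio B w u) := by
  unfold likelihoodRatio; fun_prop

theorem designLaw_add (w u : Fin d → ℝ) (B : Fin d → ℝ≥0) :
    designLaw (w + u) B = (designLaw w B).withDensity (likelihoodRatio B w u) := by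
  have (i : Fin d) : IsProbabilityMeasure ((coordLaw (w i) (B i)).withDensity
      fun x => ENNReal.ofReal (Real.exp (B i * (u i * (x - w i) - u i ^ 2 / 2)))) := by
    rw [← coordLaw_add]; infer_instance
  simp only [designLaw_eq_pi_coordLaw, Pi.add_apply, coordLaw_add]
  rw [pi_withDensity (fun i => coordLaw (w i) (B i)) fun i => by fun_prop]
  congr with y
  rw [likelihoodRatio, Real.exp_sum, ENNReal.ofReal_prod_of_nonneg fun i _ => (Real.exp_pos _).le]

theorem designLaw_eq_withDensity (v w : Fin d → ℝ) (B : Fin d → ℝ≥0) :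
    designLaw v B = (designLaw w B).withDensity (likelihoodRatio B w (v - w)) := by
  rw [← designLaw_add, add_sub_cancel]

theorem lintegral_likelihoodRatio (B : Fin d → ℝ≥0) (w u : Fin d → ℝ) :
    ∫⁻ y, likelihoodRatio B w u y ∂designLaw w B = 1 := by
  rw [← setLIntegral_univ, ← withDensity_apply _ .univ, ← designLaw_add, measure_univ]

theorem lintegral_likelihoodRatio_sq (B : Fin d → ℝ≥0) (w u : Fin d → ℝ) :
    ∫⁻ y, likelihoodRatio B w u y ^ 2 ∂designLaw w B =
      ENNReal.ofReal (Real.exp (∑ i, (B i : ℝ) * u i ^ 2)) := by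
  have hsq (y : Fin d → ℝ) : likelihoodRatio B w u y ^ 2 =
      ENNReal.ofReal (Real.exp (∑ i, (B i : ℝ) * u i ^ 2)) * likelihoodRatio B w (2 * u) y := by
    rw [likelihoodRatio, likelihoodRatio, ← ENNReal.ofReal_pow (Real.exp_pos _).le,
      ← ENNReal.ofReal_mul (Real.exp_pos _).le, ← Real.exp_nat_mul, ← Real.exp_add,
      ← Finset.sum_add_distrib, Finset.mul_sum]
    congr 3 with i
    simp only [Pi.mul_apply, Pi.ofNat_apply, Nat.cast_ofNat]
    ring
  simp_rw [hsq]
  rw [lintegral_const_mul _ (by fun_prop), lintegral_likelihoodRatio, mul_one]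

-- Chernoff's bound with the half-way tilt `(v' - v) / 2`, which optimises it.
theorem designLaw_closer_le (v v' : Fin d → ℝ) (B : Fin d → ℝ≥0) :
    designLaw v B {y | ∑ i, (B i : ℝ) * (v' i - y i) ^ 2 ≤ ∑ i, (B i : ℝ) * (v i - y i) ^ 2} ≤
      ENNReal.ofReal (Real.exp (-(∑ i, (B i : ℝ) * (v i - v' i) ^ 2) / 8)) := by
  set D := ∑ i, (B i : ℝ) * (v i - v' i) ^ 2
  set L := likelihoodRatio B v (fun i => (v' i - v i) / 2)
  have hexponent (y : Fin d → ℝ) :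
      ∑ i, (B i : ℝ) * ((v' i - v i) / 2 * (y i - v i) - ((v' i - v i) / 2) ^ 2 / 2) = D / 8 +
        (∑ i, (B i : ℝ) * (v i - y i) ^ 2 - ∑ i, (B i : ℝ) * (v' i - y i) ^ 2) / 4 := by
    rw [Finset.sum_div, ← Finset.sum_sub_distrib, Finset.sum_div, ← Finset.sum_add_distrib]
    exact Finset.sum_congr rfl fun i _ => by ring
  have hsub : {y | ∑ i, (B i : ℝ) * (v' i - y i) ^ 2 ≤ ∑ i, (B i : ℝ) * (v i - y i) ^ 2} ⊆
      {y | ENNReal.ofReal (Real.exp (D / 8)) ≤ L y} := fun y hy => by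
    refine ENNReal.ofReal_le_ofReal (Real.exp_le_exp.2 ?_)
    rw [hexponent]
    linarith [Set.mem_ofPred_eq ▸ hy]
  calc _ ≤ designLaw v B {y | ENNReal.ofReal (Real.exp (D / 8)) ≤ L y} := measure_mono hsub
    _ ≤ (∫⁻ y, L y ∂designLaw v B) / ENNReal.ofReal (Real.exp (D / 8)) :=
        meas_ge_le_lintegral_div (by fun_prop) (by simp [Real.exp_pos]) ENNReal.ofReal_ne_top
    _ = ENNReal.ofReal (Real.exp (-D / 8)) := by
        rw [lintegral_likelihoodRatio, neg_div, Real.exp_neg,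
          ENNReal.ofReal_inv_of_pos (Real.exp_pos _), one_div]

end DesignLaw

section Risk

variable {d : ℕ} {ι : Type}

theorem IsEstimator.measurableSet_eq {T : (Fin d → ℝ) → ι} (hT : IsEstimator T) (j : ι) :
    MeasurableSet {y | T y = j} :=
  @hT {j} trivial

theorem IsEstimator.prob_ne_eq_one_sub {T : (Fin d → ℝ) → ι} (hT : IsEstimator T)
    (P : Measure (Fin d → ℝ)) [IsProbabilityMeasure P] (j : ι) :
    P {y | T y ≠ j} = 1 - P {y | T y = j} :=
  prob_compl_eq_one_sub (hT.measurableSet_eq j)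

theorem measure_ne_le_maxRisk (P : ι → Measure (Fin d → ℝ)) (T : (Fin d → ℝ) → ι) (j : ι) :
    P j {y | T y ≠ j} ≤ maxRisk P T :=
  le_iSup (fun j => P j {y | T y ≠ j}) j

theorem lawMinimaxRisk_le_one [Nonempty ι] (P : ι → Measure (Fin d → ℝ))
    [∀ j, IsProbabilityMeasure (P j)] : lawMinimaxRisk P ≤ 1 :=
  iInf₂_le_of_le (fun _ => Classical.arbitrary ι) (@measurable_const _ _ ⊤ _ _)
    (iSup_le fun _ => prob_le_one)

-- The events `{T = S c}` are disjoint, so one of them has `Q`-probability at most `1 / card κ`;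
-- the Cauchy-Schwarz inequality transfers this bound to `P (S c)`.
theorem one_sub_rpow_le_maxRisk {κ : Type*} [Fintype κ] [Nonempty κ] {P : ι → Measure (Fin d → ℝ)}
    [∀ j, IsProbabilityMeasure (P j)] {Q : Measure (Fin d → ℝ)} [IsProbabilityMeasure Q]
    {S : κ → ι} (hS : Function.Injective S) {L : κ → (Fin d → ℝ) → ℝ≥0∞}
    (hL : ∀ c, Measurable (L c)) (hP : ∀ c, P (S c) = Q.withDensity (L c)) {K : ℝ≥0∞}
    (hK : ∀ c, ∫⁻ y, L c y ^ 2 ∂Q ≤ K) {T : (Fin d → ℝ) → ι} (hT : IsEstimator T) :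
    1 - (K / Fintype.card κ) ^ (1 / 2 : ℝ) ≤ maxRisk P T := by
  have hsum : ∑ c, Q {y | T y = S c} ≤ ∑ _c : κ, (Fintype.card κ : ℝ≥0∞)⁻¹ := by
    rw [Finset.sum_const, Finset.card_univ, nsmul_eq_mul, ENNReal.mul_inv_cancel
      (Nat.cast_ne_zero.2 Fintype.card_ne_zero) (ENNReal.natCast_ne_top _)]
    refine (sum_measure_le_measure_univ (fun c _ => (hT.measurableSet_eq _).nullMeasurableSet)
      fun c _ c' _ hc => ?_).trans_eq measure_univ
    exact (Set.disjoint_left.2 fun y hy hy' => hc (hS (hy.symm.trans hy'))).aedisjoint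
  obtain ⟨c, -, hc⟩ := ENNReal.exists_le_of_sum_le Finset.univ_nonempty hsum
  refine le_trans (tsub_le_tsub_left ?_ _)
    ((hT.prob_ne_eq_one_sub _ _).symm.trans_le (measure_ne_le_maxRisk P T (S c)))
  calc P (S c) {y | T y = S c}
      ≤ Q {y | T y = S c} ^ (1 / 2 : ℝ) * (∫⁻ y, L c y ^ 2 ∂Q) ^ (1 / 2 : ℝ) := by
        rw [hP]
        exact withDensity_apply_le_rpow_mul_rpow Q (hL c) (hT.measurableSet_eq _)
    _ ≤ (Fintype.card κ : ℝ≥0∞)⁻¹ ^ (1 / 2 : ℝ) * K ^ (1 / 2 : ℝ) := by gcongr; exact hK c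
    _ = (K / Fintype.card κ) ^ (1 / 2 : ℝ) := by
        rw [← ENNReal.mul_rpow_of_nonneg _ _ (by norm_num), mul_comm, ENNReal.div_eq_inv_mul,
          mul_comm]

theorem one_sub_rpow_exp_le_maxRisk {κ : Type*} [Fintype κ] [Nonempty κ] (v : ι → Fin d → ℝ)
    (B : Fin d → ℝ≥0) {S : κ → ι} (hS : Function.Injective S) (w : Fin d → ℝ) {ρ : ℝ}
    (hρ : ∀ c, ∑ i, (B i : ℝ) * (v (S c) i - w i) ^ 2 ≤ ρ) {T : (Fin d → ℝ) → ι}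
    (hT : IsEstimator T) :
    1 - (ENNReal.ofReal (Real.exp ρ) / Fintype.card κ) ^ (1 / 2 : ℝ) ≤
      maxRisk (fun j => designLaw (v j) B) T :=
  one_sub_rpow_le_maxRisk hS (fun c => measurable_likelihoodRatio B w (v (S c) - w))
    (fun c => designLaw_eq_withDensity (v (S c)) w B)
    (fun c => (lintegral_likelihoodRatio_sq B w _).trans_le
      (ENNReal.ofReal_le_ofReal (Real.exp_le_exp.2 (hρ c)))) hT

theorem maxRisk_eq_lawMinimaxRisk_of_bayes [Fintype ι] {P : ι → Measure (Fin d → ℝ)}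
    [∀ j, IsProbabilityMeasure (P j)] {T : (Fin d → ℝ) → ι} (hT : IsEstimator T)
    (hequalizer : ∀ j l, P j {y | T y = j} = P l {y | T y = l})
    (hbayes : ∀ T', IsEstimator T' → ∑ j, P j {y | T' y = j} ≤ ∑ j, P j {y | T y = j}) :
    maxRisk P T = lawMinimaxRisk P := by
  refine le_antisymm (le_iInf₂ fun T' hT' => iSup_le fun j => ?_) (iInf₂_le T hT)
  obtain ⟨l, -, hl⟩ := ENNReal.exists_le_of_sum_le ⟨j, Finset.mem_univ j⟩ (hbayes T' hT')
  calc P j {y | T y ≠ j} = 1 - P l {y | T y = l} := by rw [hT.prob_ne_eq_one_sub, hequalizer j l]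
    _ ≤ 1 - P l {y | T' y = l} := tsub_le_tsub_left hl 1
    _ = P l {y | T' y ≠ l} := (hT'.prob_ne_eq_one_sub _ l).symm
    _ ≤ maxRisk P T' := measure_ne_le_maxRisk P T' l

end Risk

section MaximumLikelihood

variable {d : ℕ} {ι : Type} {v : ι → Fin d → ℝ} {B : Fin d → ℝ≥0} {T T' : (Fin d → ℝ) → ι}

theorem exists_isEstimator_argmin [Finite ι] [Nonempty ι] {q : ι → (Fin d → ℝ) → ℝ}
    (hq : ∀ j, Measurable (q j)) :
    ∃ T : (Fin d → ℝ) → ι, IsEstimator T ∧ ∀ y j, q (T y) y ≤ q j y := by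
  classical
  obtain ⟨f, hf⟩ := exists_surjective_nat ι
  have hex (y : Fin d → ℝ) : ∃ n, ∀ j, q (f n) y ≤ q j y := by
    obtain ⟨j₀, hj₀⟩ := Finite.exists_min fun j => q j y
    obtain ⟨n, rfl⟩ := hf j₀
    exact ⟨n, hj₀⟩
  have hmeas (n : ℕ) : MeasurableSet {y | ∀ j, q (f n) y ≤ q j y} := by
    rw [Set.ofPred_forall]
    exact .iInter fun j => measurableSet_le (hq _) (hq j)
  exact ⟨fun y => f (Nat.find (hex y)),
    (@measurable_from_nat _ ⊤ f).comp (measurable_find hex hmeas), fun y => Nat.find_spec (hex y)⟩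

theorem exists_isDesignMLE [Finite ι] [Nonempty ι] (v : ι → Fin d → ℝ) (B : Fin d → ℝ≥0) :
    ∃ T, IsDesignMLE v B T :=
  exists_isEstimator_argmin (q := fun j y => ∑ i, (B i : ℝ) * (v j i - y i) ^ 2)
    fun j => by fun_prop

theorem isMLE_iff_isDesignMLE_one : IsMLE v T ↔ IsDesignMLE v 1 T := by
  simp [IsMLE, IsDesignMLE]

theorem exists_isMLE [Finite ι] [Nonempty ι] (v : ι → Fin d → ℝ) : ∃ T, IsMLE v T :=
  (exists_isDesignMLE v 1).imp fun _ => isMLE_iff_isDesignMLE_one.2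

theorem IsDesignMLE.sum_measure_eq_le [Fintype ι] (hT : IsDesignMLE v B T)
    (hT' : IsEstimator T') :
    ∑ j, designLaw (v j) B {y | T' y = j} ≤ ∑ j, designLaw (v j) B {y | T y = j} := by
  have hL (j : ι) : Measurable (likelihoodRatio B 0 (v j - 0)) := by fun_prop
  simp_rw [fun j => designLaw_eq_withDensity (v j) 0 B]
  rw [sum_withDensity_eq_lintegral _ hL hT'.measurableSet_eq,
    sum_withDensity_eq_lintegral _ hL hT.1.measurableSet_eq]
  refine lintegral_mono fun y => ENNReal.ofReal_le_ofReal (Real.exp_le_exp.2 ?_)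
  have hexponent (j : ι) :
      ∑ i, (B i : ℝ) * ((v j - 0) i * (y i - (0 : Fin d → ℝ) i) - (v j - 0) i ^ 2 / 2) =
        (∑ i, (B i : ℝ) * y i ^ 2 - ∑ i, (B i : ℝ) * (v j i - y i) ^ 2) / 2 := by
    rw [← Finset.sum_sub_distrib, Finset.sum_div]
    refine Finset.sum_congr rfl fun i _ => ?_
    simp only [sub_zero, Pi.zero_apply]
    ring
  rw [hexponent, hexponent]
  linarith [hT.2 y (T' y)]

theorem IsDesignMLE.maxRisk_le_sedf [Fintype ι] [DecidableEq ι] (hT : IsDesignMLE v B T) :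
    maxRisk (fun j => designLaw (v j) B) T ≤ ENNReal.ofReal (sedf v 8 B) := by
  refine iSup_le fun j => ?_
  have hsub : {y | T y ≠ j} ⊆ ⋃ l ∈ ({l | l ≠ j} : Finset ι),
      {y | ∑ i, (B i : ℝ) * (v l i - y i) ^ 2 ≤ ∑ i, (B i : ℝ) * (v j i - y i) ^ 2} :=
    fun y hy => Set.mem_iUnion₂.2 ⟨T y, by simpa using hy, hT.2 y j⟩
  calc designLaw (v j) B {y | T y ≠ j}
      ≤ ∑ l with l ≠ j, designLaw (v j) B
          {y | ∑ i, (B i : ℝ) * (v l i - y i) ^ 2 ≤ ∑ i, (B i : ℝ) * (v j i - y i) ^ 2} :=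
        (measure_mono hsub).trans (measure_biUnion_finset_le _ _)
    _ ≤ ∑ l with l ≠ j, ENNReal.ofReal
          (Real.exp (-(∑ i, (B i : ℝ) * (v j i - v l i) ^ 2) / 8)) :=
        Finset.sum_le_sum fun l _ => designLaw_closer_le (v j) (v l) B
    _ = ENNReal.ofReal
          (∑ l with l ≠ j, Real.exp (-(∑ i, (B i : ℝ) * (v j i - v l i) ^ 2) / 8)) :=
        (ENNReal.ofReal_sum_of_nonneg fun l _ => (Real.exp_pos _).le).symm
    _ ≤ ENNReal.ofReal (sedf v 8 B) :=
        ENNReal.ofReal_le_ofReal (le_ciSup (f := fun j => ∑ l with l ≠ j,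
          Real.exp (-(∑ i, (B i : ℝ) * (v j i - v l i) ^ 2) / 8)) (Set.finite_range _).bddAbove j)

theorem designLaw_tie_eq_zero (w : Fin d → ℝ) {m m' : Fin d → ℝ}
    (hm : (fun i => (B i : ℝ) * m i) ≠ fun i => (B i : ℝ) * m' i) :
    designLaw w B {y | ∑ i, (B i : ℝ) * (m i - y i) ^ 2 = ∑ i, (B i : ℝ) * (m' i - y i) ^ 2} =
      0 := by
  obtain ⟨i, hi⟩ := Function.ne_iff.1 hm
  have hBi : B i ≠ 0 := fun h => hi (by simp [h])
  have := nullSingletonClass_coordLaw (w i) hBi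
  have hnormal : (B i : ℝ) * m i - B i * m' i ≠ 0 := sub_ne_zero.2 hi
  rw [designLaw_eq_pi_coordLaw]
  refine measure_mono_null (fun y hy => ?_) (pi_hyperplane_eq_zero (fun i => coordLaw (w i) (B i))
    (a := fun i => (B i : ℝ) * m i - B i * m' i) hnormal
    ((∑ i, (B i : ℝ) * m i ^ 2 - ∑ i, (B i : ℝ) * m' i ^ 2) / 2))
  have hdiff : ∑ i, (B i : ℝ) * (m i - y i) ^ 2 - ∑ i, (B i : ℝ) * (m' i - y i) ^ 2 =
      (∑ i, (B i : ℝ) * m i ^ 2 - ∑ i, (B i : ℝ) * m' i ^ 2) -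
        2 * ∑ i, ((B i : ℝ) * m i - B i * m' i) * y i := by
    simp only [Finset.mul_sum, ← Finset.sum_sub_distrib]
    exact Finset.sum_congr rfl fun i _ => by ring
  rw [Set.mem_ofPred_eq] at hy ⊢
  linarith

theorem IsDesignMLE.ae_eq [Finite ι] (hv : Function.Injective fun j i => (B i : ℝ) * v j i)
    (hT : IsDesignMLE v B T) (hT' : IsDesignMLE v B T') (w : Fin d → ℝ) :
    T =ᵐ[designLaw w B] T' := by
  have hties : ∀ᵐ y ∂designLaw w B, ∀ j l, j ≠ l →
      ∑ i, (B i : ℝ) * (v j i - y i) ^ 2 ≠ ∑ i, (B i : ℝ) * (v l i - y i) ^ 2 := by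
    refine ae_all_iff.2 fun j => ae_all_iff.2 fun l => ?_
    by_cases hjl : j = l
    · simp [hjl]
    · simpa [hjl, ae_iff] using designLaw_tie_eq_zero w (hv.ne hjl)
  filter_upwards [hties] with y hy
  by_contra hne
  exact hy _ _ hne (le_antisymm (hT.2 y _) (hT'.2 y _))

end MaximumLikelihood

section Symmetry

variable {d : ℕ} {ι : Type} {v : ι → Fin d → ℝ} {B : Fin d → ℝ≥0} {σ : Equiv.Perm (Fin d)}
  {e : Equiv.Perm ι}

/-- The family `v` is invariant under the permutation `σ` of the coordinates, the hypotheses being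
permuted by `e`. -/
def IsSymmetry (v : ι → Fin d → ℝ) (σ : Equiv.Perm (Fin d)) (e : Equiv.Perm ι) : Prop :=
  ∀ j i, v (e j) (σ i) = v j i

theorem IsDesignMLE.conj {T : (Fin d → ℝ) → ι} (hT : IsDesignMLE v B T) (hσ : IsSymmetry v σ e)
    (hB : B ∘ σ = B) : IsDesignMLE v B fun y => e.symm (T (y ∘ σ.symm)) := by
  refine ⟨(@measurable_from_top _ _ ⊤ e.symm).comp (hT.1.comp (by fun_prop)), fun y j => ?_⟩
  have hcost (l : ι) : ∑ i, (B i : ℝ) * (v l i - y i) ^ 2 =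
      ∑ i, (B i : ℝ) * (v (e l) i - (y ∘ σ.symm) i) ^ 2 := by
    rw [← Equiv.sum_comp σ fun i => (B i : ℝ) * (v (e l) i - (y ∘ σ.symm) i) ^ 2]
    exact Finset.sum_congr rfl fun i _ => by
      rw [hσ l i, ← congrFun hB i, Function.comp_apply, Function.comp_apply,
        Equiv.symm_apply_apply]
  rw [hcost, hcost, Equiv.apply_symm_apply]
  exact hT.2 _ _

theorem IsDesignMLE.measure_eq_of_isSymmetry [Finite ι]
    (hv : Function.Injective fun j i => (B i : ℝ) * v j i) {T : (Fin d → ℝ) → ι}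
    (hT : IsDesignMLE v B T) (hσ : IsSymmetry v σ e) (hB : B ∘ σ = B) (j : ι) :
    designLaw (v (e j)) B {y | T y = e j} = designLaw (v j) B {y | T y = j} := by
  have hconj := hT.conj hσ hB
  have hσ_preserving : MeasurePreserving (· ∘ σ) (designLaw (v (e j)) B) (designLaw (v j) B) := by
    simpa only [hB, show v (e j) ∘ σ = v j from funext (hσ j)] using
      measurePreserving_comp_perm (v (e j)) B σ
  calc designLaw (v (e j)) B {y | T y = e j}
      = designLaw (v (e j)) B ((· ∘ σ) ⁻¹' {y | e.symm (T (y ∘ σ.symm)) = j}) := by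
        congr 1 with y
        simp [Function.comp_assoc, Equiv.symm_apply_eq]
    _ = designLaw (v j) B {y | e.symm (T (y ∘ σ.symm)) = j} :=
        hσ_preserving.measure_preimage (hconj.1.measurableSet_eq j).nullMeasurableSet
    _ = designLaw (v j) B {y | T y = j} := by
        refine measure_congr ?_
        filter_upwards [hconj.ae_eq hv hT (v j)] with y hy
        exact congrArg (· = j) hy

theorem IsDesignMLE.maxRisk_eq_lawMinimaxRisk [Finite ι]
    (hv : Function.Injective fun j i => (B i : ℝ) * v j i)
    (htransitive : ∀ j l, ∃ σ e, IsSymmetry v σ e ∧ B ∘ σ = B ∧ e j = l)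
    {T : (Fin d → ℝ) → ι} (hT : IsDesignMLE v B T) :
    maxRisk (fun j => designLaw (v j) B) T = lawMinimaxRisk fun j => designLaw (v j) B := by
  have := Fintype.ofFinite ι
  refine maxRisk_eq_lawMinimaxRisk_of_bayes hT.1 (fun j l => ?_) fun T' => hT.sum_measure_eq_le
  obtain ⟨σ, e, hσ, hB, rfl⟩ := htransitive j l
  exact (hT.measure_eq_of_isSymmetry hv hσ hB j).symm

end Symmetry

section SamplingExponentiatedDistance

variable {d : ℕ} {ι : Type} [Fintype ι] [DecidableEq ι]

theorem sedf_comp_perm {v : ι → Fin d → ℝ} {σ : Equiv.Perm (Fin d)} {e : Equiv.Perm ι}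
    (hσ : IsSymmetry v σ e) (α : ℝ) (B : Fin d → ℝ≥0) : sedf v α (B ∘ σ) = sedf v α B := by
  have hdist (j l : ι) : ∑ i, ((B ∘ σ) i : ℝ) * (v j i - v l i) ^ 2 =
      ∑ i, (B i : ℝ) * (v (e j) i - v (e l) i) ^ 2 := by
    rw [← Equiv.sum_comp σ fun i => (B i : ℝ) * (v (e j) i - v (e l) i) ^ 2]
    simp only [Function.comp_apply, hσ _ _]
  refine e.iSup_congr fun j => (Finset.sum_equiv e (fun l => by simp) fun l _ => ?_).symm
  rw [hdist]

theorem antitone_sedf (v : ι → Fin d → ℝ) {α : ℝ} (hα : 0 ≤ α) : Antitone (sedf v α) :=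
  fun _ _ hB => ciSup_mono (Set.finite_range _).bddAbove fun _ =>
    Finset.sum_le_sum fun _ _ => by gcongr; exact hB _

theorem sedf_nonneg (v : ι → Fin d → ℝ) (α : ℝ) (B : Fin d → ℝ≥0) : 0 ≤ sedf v α B :=
  Real.iSup_nonneg fun _ => Finset.sum_nonneg fun _ _ => (Real.exp_pos _).le

theorem sedf_sum_smul_le {κ : Type*} [Fintype κ] (v : ι → Fin d → ℝ) (α : ℝ) {p : κ → ℝ≥0}
    (hp : ∑ c, p c = 1) (B : κ → Fin d → ℝ≥0) :
    sedf v α (∑ c, p c • B c) ≤ ∑ c, p c * sedf v α (B c) := by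
  refine Real.iSup_le (fun j => ?_)
    (Finset.sum_nonneg fun c _ => mul_nonneg (p c).2 (sedf_nonneg v α (B c)))
  have hjensen (l : ι) : Real.exp (-(∑ i, ((∑ c, p c • B c) i : ℝ) * (v j i - v l i) ^ 2) / α) ≤
      ∑ c, (p c : ℝ) * Real.exp (-(∑ i, (B c i : ℝ) * (v j i - v l i) ^ 2) / α) := by
    have hexponent : -(∑ i, ((∑ c, p c • B c) i : ℝ) * (v j i - v l i) ^ 2) / α =
        ∑ c, (p c : ℝ) * (-(∑ i, (B c i : ℝ) * (v j i - v l i) ^ 2) / α) := by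
      simp only [Finset.sum_apply, Pi.smul_apply, smul_eq_mul, NNReal.coe_sum, NNReal.coe_mul,
        Finset.sum_mul, Finset.mul_sum, mul_div_assoc', mul_neg, ← Finset.sum_div,
        Finset.sum_neg_distrib, mul_assoc]
      rw [Finset.sum_comm]
    rw [hexponent]
    exact convexOn_exp.map_sum_le (fun c _ => (p c).2) (by exact_mod_cast hp)
      fun _ _ => Set.mem_univ _
  calc ∑ l with l ≠ j, Real.exp (-(∑ i, ((∑ c, p c • B c) i : ℝ) * (v j i - v l i) ^ 2) / α)
      ≤ ∑ l with l ≠ j, ∑ c, (p c : ℝ) *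
          Real.exp (-(∑ i, (B c i : ℝ) * (v j i - v l i) ^ 2) / α) :=
        Finset.sum_le_sum fun l _ => hjensen l
    _ = ∑ c, (p c : ℝ) * ∑ l with l ≠ j,
          Real.exp (-(∑ i, (B c i : ℝ) * (v j i - v l i) ^ 2) / α) := by
        rw [Finset.sum_comm]; simp only [Finset.mul_sum]
    _ ≤ ∑ c, p c * sedf v α (B c) := by
        gcongr with c
        exact le_ciSup (f := fun j => ∑ l with l ≠ j,
          Real.exp (-(∑ i, (B c i : ℝ) * (v j i - v l i) ^ 2) / α)) (Set.finite_range _).bddAbove j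

theorem sum_uniformDesign_le (d : ℕ) (τ : ℝ≥0) : ∑ i, uniformDesign d τ i ≤ τ := by
  simp only [uniformDesign, Finset.sum_const, Finset.card_univ, Fintype.card_fin, nsmul_eq_mul]
  rw [mul_div_left_comm]
  exact mul_le_of_le_one_right zero_le (div_self_le_one _)

-- The average of all cyclic shifts of `B` is the uniform design with the same budget.
theorem sedf_uniformDesign_le [NeZero d] {v : ι → Fin d → ℝ}
    (hv : ∀ c, ∃ e, IsSymmetry v (Equiv.addRight c) e) {α : ℝ} (hα : 0 ≤ α) {τ : ℝ≥0}
    {B : Fin d → ℝ≥0} (hB : ∑ i, B i ≤ τ) : sedf v α (uniformDesign d τ) ≤ sedf v α B := by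
  have hd : (d : ℝ≥0) ≠ 0 := NeZero.ne _
  have haverage : ∑ c : Fin d, (d : ℝ≥0)⁻¹ • (B ∘ Equiv.addRight c) ≤ uniformDesign d τ :=
    fun i => by
      have hshift : ∑ c, B (i + c) = ∑ c, B c := Equiv.sum_comp (Equiv.addLeft i) B
      simp only [Finset.sum_apply, Pi.smul_apply, Function.comp_apply, Equiv.coe_addRight,
        smul_eq_mul, ← Finset.mul_sum, uniformDesign]
      rw [hshift, ← div_eq_inv_mul]
      gcongr
  calc sedf v α (uniformDesign d τ)
      ≤ sedf v α (∑ c : Fin d, (d : ℝ≥0)⁻¹ • (B ∘ Equiv.addRight c)) :=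
        antitone_sedf v hα haverage
    _ ≤ ∑ c : Fin d, ((d : ℝ≥0)⁻¹ : ℝ≥0) * sedf v α (B ∘ Equiv.addRight c) :=
        sedf_sum_smul_le v α (by simp [hd]) _
    _ = sedf v α B := by
        have hshift (c : Fin d) : sedf v α (B ∘ Equiv.addRight c) = sedf v α B :=
          (hv c).elim fun _ hσ => sedf_comp_perm hσ α B
        have hdR : (d : ℝ) ≠ 0 := NeZero.ne _
        simp_rw [hshift]
        simp [hdR]

end SamplingExponentiatedDistance

section KSets

variable {d k : ℕ}

theorem nonempty_kSubset (h : k ≤ d) : Nonempty (KSubset d k) := by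
  obtain ⟨S, -, hS⟩ := Finset.exists_subset_card_eq (s := (Finset.univ : Finset (Fin d))) (n := k)
    (by simpa using h)
  exact ⟨⟨S, hS⟩⟩

/-- The action of a permutation of the coordinates on the `k`-subsets. -/
def permKSubset (σ : Equiv.Perm (Fin d)) : Equiv.Perm (KSubset d k) :=
  (Equiv.finsetCongr σ).subtypeEquiv fun S => by simp

theorem isSymmetry_kSets (μ : ℝ) (σ : Equiv.Perm (Fin d)) :
    IsSymmetry (kSets d k μ) σ (permKSubset σ) := fun S i => by
  simp [kSets, permKSubset]

theorem exists_permKSubset_eq (S R : KSubset d k) : ∃ σ, permKSubset σ S = R := by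
  have e : S.1 ≃ R.1 := Fintype.equivOfCardEq (by simp [S.2, R.2])
  refine ⟨e.extendSubtype, Subtype.ext (Finset.eq_of_subset_of_card_le (fun x hx => ?_) ?_)⟩
  · obtain ⟨y, hy, rfl⟩ := Finset.mem_map.1 hx
    exact e.extendSubtype_mem y hy
  · rw [R.2, (permKSubset _ S).2]

theorem kSets_injective {μ : ℝ} (hμ : μ ≠ 0) : Function.Injective (kSets d k μ) := by
  refine fun S R h => Subtype.ext (Finset.ext fun i => ?_)
  have hi := congrFun h i
  by_cases hS : i ∈ S.1 <;> by_cases hR : i ∈ R.1 <;> simp_all [kSets]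

theorem sum_mul_kSets_sub_sq {l : ℕ} (b : Fin d → ℝ) (μ : ℝ) (S : KSubset d k) (R : KSubset d l) :
    ∑ i, b i * (kSets d k μ S i - kSets d l μ R i) ^ 2 = μ ^ 2 * ∑ i ∈ S.1 ∆ R.1, b i := by
  rw [Finset.mul_sum, ← Finset.univ_inter (S.1 ∆ R.1), ← Finset.sum_ite_mem]
  refine Finset.sum_congr rfl fun i _ => ?_
  by_cases hS : i ∈ S.1 <;> by_cases hR : i ∈ R.1 <;>
    simp [kSets, Finset.mem_symmDiff, hS, hR, mul_comm]

theorem maxRisk_eq_minimaxRisk_of_isMLE {μ : ℝ} (hμ : μ ≠ 0) {T : (Fin d → ℝ) → KSubset d k}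
    (hT : IsMLE (kSets d k μ) T) :
    maxRisk (fun S => isoLaw (kSets d k μ S)) T = minimaxRisk (kSets d k μ) := by
  simp only [minimaxRisk, isoLaw_eq_designLaw_one]
  refine (isMLE_iff_isDesignMLE_one.1 hT).maxRisk_eq_lawMinimaxRisk
    (by simpa using kSets_injective hμ) fun S R => ?_
  obtain ⟨σ, hσ⟩ := exists_permKSubset_eq S R
  exact ⟨σ, permKSubset σ, isSymmetry_kSets μ σ, rfl, hσ⟩

theorem sedf_kSets_uniformDesign_le (d k : ℕ) (μ : ℝ) {α : ℝ} (hα : 0 ≤ α) {τ : ℝ≥0}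
    {B : Fin d → ℝ≥0} (hB : ∑ i, B i ≤ τ) :
    sedf (kSets d k μ) α (uniformDesign d τ) ≤ sedf (kSets d k μ) α B := by
  obtain _ | n := d
  · rw [Subsingleton.elim (uniformDesign 0 τ) B]
  · exact sedf_uniformDesign_le (fun c => ⟨_, isSymmetry_kSets μ _⟩) hα hB

-- `R ↦ S ∆ R` maps the `R ≠ S` injectively to the nonempty sets; the sum over all sets is binomial.
theorem sedf_kSets_const_le (d k : ℕ) (μ α : ℝ) (b : ℝ≥0) :
    sedf (kSets d k μ) α (fun _ => b) ≤ (1 + Real.exp (-(b * μ ^ 2) / α)) ^ d - 1 := by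
  set q := Real.exp (-(b * μ ^ 2) / α)
  have hq : 0 ≤ q := (Real.exp_pos _).le
  refine Real.iSup_le (fun S => ?_) (sub_nonneg.2 (one_le_pow₀ (by linarith)))
  have hterm (R : KSubset d k) :
      Real.exp (-(∑ i, (b : ℝ) * (kSets d k μ S i - kSets d k μ R i) ^ 2) / α) =
        q ^ #(S.1 ∆ R.1) := by
    rw [sum_mul_kSets_sub_sq (fun _ => (b : ℝ)), ← Real.exp_nat_mul, Finset.sum_const,
      nsmul_eq_mul]
    ring_nf
  have hinj : Function.Injective fun R : KSubset d k => S.1 ∆ R.1 := fun R R' h =>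
    Subtype.ext (symmDiff_right_injective _ h)
  calc ∑ R with R ≠ S, Real.exp (-(∑ i, (b : ℝ) * (kSets d k μ S i - kSets d k μ R i) ^ 2) / α)
      = ∑ U ∈ ({R | R ≠ S} : Finset _).image fun R => S.1 ∆ R.1, q ^ #U := by
        simp only [hterm, Finset.sum_image hinj.injOn]
    _ ≤ ∑ U ∈ Finset.univ.erase ∅, q ^ #U := by
        refine Finset.sum_le_sum_of_subset_of_nonneg (fun U hU => ?_) fun U _ _ => by positivity
        obtain ⟨R, hR, rfl⟩ := Finset.mem_image.1 hU
        simpa [Subtype.ext_iff, eq_comm, ← Finset.bot_eq_empty] using hR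
    _ = (1 + q) ^ d - 1 := by
        rw [Finset.sum_erase_eq_sub (Finset.mem_univ _)]
        simpa [add_comm] using Fintype.sum_pow_mul_eq_add_pow (Fin d) q 1

theorem maxRisk_uniformDesign_le {μ : ℝ} {τ : ℝ≥0} {T : (Fin d → ℝ) → KSubset d k}
    (hT : IsDesignMLE (kSets d k μ) (uniformDesign d τ) T) :
    maxRisk (fun S => designLaw (kSets d k μ S) (uniformDesign d τ)) T ≤
      ENNReal.ofReal (Real.exp (d * Real.exp (-(τ / d * μ ^ 2) / 8)) - 1) := by
  refine hT.maxRisk_le_sedf.trans (ENNReal.ofReal_le_ofReal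
    ((sedf_kSets_const_le d k μ 8 (τ / d)).trans (sub_le_sub_right ?_ 1)))
  rw [Real.exp_nat_mul, add_comm, NNReal.coe_div, NNReal.coe_natCast]
  exact pow_le_pow_left₀ (by positivity) (Real.add_one_le_exp _) d

theorem three_mul_le_card_le_four_mul_div {B : Fin d → ℝ≥0} {τ : ℝ≥0} (hB : ∑ i, B i ≤ τ) :
    3 * d ≤ 4 * #{i | B i ≤ 4 * (τ / d)} := by
  have hcompl := Finset.card_filter_add_card_filter_not (s := Finset.univ)
    fun i => B i ≤ 4 * (τ / d)
  simp only [not_le, Finset.card_univ, Fintype.card_fin] at hcompl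
  suffices 4 * #{i | 4 * (τ / d) < B i} ≤ d by lia
  by_contra! hmany
  have hd : (d : ℝ≥0) ≠ 0 := by
    rintro h
    obtain rfl : d = 0 := by exact_mod_cast h
    simp at hmany
  have hcard : (d : ℝ≥0) ≤ 4 * #{i | 4 * (τ / d) < B i} := by exact_mod_cast hmany.le
  refine hB.not_gt ?_
  calc τ = d * (τ / d) := (mul_div_cancel₀ _ hd).symm
    _ ≤ 4 * #{i | 4 * (τ / d) < B i} * (τ / d) := by gcongr
    _ = ∑ i with 4 * (τ / d) < B i, 4 * (τ / d) := by
        rw [Finset.sum_const, nsmul_eq_mul]; ring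
    _ < ∑ i with 4 * (τ / d) < B i, B i :=
        Finset.sum_lt_sum_of_nonempty (Finset.card_pos.1 (by lia))
          fun i hi => (Finset.mem_filter.1 hi).2
    _ ≤ ∑ i, B i := Finset.sum_le_sum_of_subset (Finset.subset_univ _)

theorem exists_card_symmDiff_singleton_eq (hk : 1 ≤ k) (hkd : k < d) {L : Finset (Fin d)}
    (hL : 3 * d ≤ 4 * #L) :
    ∃ A C, C ⊆ L ∧ d ≤ 4 * #C ∧ ∀ c ∈ C, #(A ∆ {c}) = k := by
  rcases le_or_gt (2 * k) d with h | h
  · obtain ⟨A, -, hA⟩ := Finset.exists_subset_card_eq (s := (Finset.univ : Finset (Fin d)))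
      (n := k - 1) (by simp; lia)
    refine ⟨A, L \ A, Finset.sdiff_subset, ?_, fun c hc => ?_⟩
    · have := Finset.le_card_sdiff A L
      lia
    · have hcA := Finset.disjoint_singleton_right.2 (Finset.mem_sdiff.1 hc).2
      rw [hcA.symmDiff_eq_sup, Finset.sup_eq_union, Finset.card_union_of_disjoint hcA, hA,
        Finset.card_singleton, Nat.sub_add_cancel hk]
  · obtain ⟨A, -, hA⟩ := Finset.exists_subset_card_eq (s := (Finset.univ : Finset (Fin d)))
      (n := k + 1) (by simpa using hkd)
    refine ⟨A, A ∩ L, Finset.inter_subset_right, ?_, fun c hc => ?_⟩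
    · have hunion := Finset.card_union_add_card_inter A L
      have := card_finset_fin_le (A ∪ L)
      lia
    · have hcA : {c} ⊆ A := Finset.singleton_subset_iff.2 (Finset.mem_inter.1 hc).1
      rw [symmDiff_of_ge hcA, Finset.card_sdiff_of_subset hcA, hA,
        Finset.card_singleton, Nat.add_sub_cancel]

-- The hypotheses `A ∆ {c}` differ from the common centre `A` only in the barely sampled coordinate
-- `c`, and there are at least `d / 4` of them.
theorem one_sub_rpow_le_budgetMinimaxRisk_kSets (hk : 1 ≤ k) (hkd : k < d) (μ : ℝ) (τ : ℝ≥0) :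
    1 - ENNReal.ofReal (4 * (Real.exp (4 * (τ / d * μ ^ 2)) / d)) ^ (1 / 2 : ℝ) ≤
      budgetMinimaxRisk (kSets d k μ) τ := by
  refine le_iInf₂ fun B hB => le_iInf₂ fun T hT => ?_
  obtain ⟨A, C, hCL, hdC, hAC⟩ := exists_card_symmDiff_singleton_eq hk hkd
    (three_mul_le_card_le_four_mul_div hB)
  have hC : 0 < #C := by lia
  have : Nonempty C := (Finset.card_pos.1 hC).to_subtype
  let S (c : C) : KSubset d k := ⟨A ∆ {c.1}, hAC c c.2⟩
  have hS : Function.Injective S := fun c c' h => Subtype.ext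
    (Finset.singleton_injective (symmDiff_right_injective A (congrArg Subtype.val h)))
  have hdist (c : C) : ∑ i, (B i : ℝ) * (kSets d k μ (S c) i - kSets d #A μ ⟨A, rfl⟩ i) ^ 2 ≤
      4 * (τ / d * μ ^ 2) := by
    have hBc : (B c : ℝ) ≤ 4 * (τ / d) := by exact_mod_cast (Finset.mem_filter.1 (hCL c.2)).2
    rw [sum_mul_kSets_sub_sq fun i => (B i : ℝ), symmDiff_comm, symmDiff_symmDiff_cancel_left,
      Finset.sum_singleton]
    nlinarith [sq_nonneg μ]
  have hcount : ENNReal.ofReal (Real.exp (4 * (τ / d * μ ^ 2))) / Fintype.card C ≤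
      ENNReal.ofReal (4 * (Real.exp (4 * (τ / d * μ ^ 2)) / d)) := by
    have hdC' : (d : ℝ) ≤ 4 * #C := by exact_mod_cast hdC
    have hd : (0 : ℝ) < d := by exact_mod_cast pos_of_gt hkd
    have hC' : (0 : ℝ) < #C := by exact_mod_cast hC
    rw [Fintype.card_coe, ← ENNReal.ofReal_natCast, ← ENNReal.ofReal_div_of_pos hC']
    refine ENNReal.ofReal_le_ofReal ?_
    rw [← mul_div_assoc, div_le_div_iff₀ hC' hd]
    nlinarith [Real.exp_pos (4 * (τ / d * μ ^ 2))]
  calc _ ≤ 1 - (ENNReal.ofReal (Real.exp (4 * (τ / d * μ ^ 2))) / Fintype.card C) ^ (1 / 2 : ℝ) :=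
        by gcongr
    _ ≤ _ := one_sub_rpow_exp_le_maxRisk (kSets d k μ) B hS _ hdist hT

end KSets

section Asymptotics

variable {β : Type*} {l : Filter β} {x s : β → ℝ}

theorem tendsto_mul_exp_neg_of_isLittleO (hx : Tendsto x l atTop) (hs : ∀ n, 0 ≤ s n)
    (h : (fun n => Real.log (x n)) =o[l] s) {c : ℝ} (hc : 0 < c) :
    Tendsto (fun n => x n * Real.exp (-(c * s n))) l (𝓝 0) := by
  have hexponent : Tendsto (fun n => Real.log (x n) - c * s n) l atBot := by
    refine tendsto_atBot_mono' l ?_ (tendsto_neg_atTop_atBot.comp (Real.tendsto_log_atTop.comp hx))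
    filter_upwards [h.bound (half_pos hc)] with n hn
    rw [Real.norm_of_nonneg (hs n)] at hn
    simp only [Function.comp_apply]
    linarith [Real.le_norm_self (Real.log (x n))]
  refine (Real.tendsto_exp_atBot.comp hexponent).congr' ?_
  filter_upwards [hx.eventually_gt_atTop 0] with n hn
  rw [Function.comp_apply, sub_eq_add_neg, Real.exp_add, Real.exp_log hn]

theorem tendsto_exp_div_of_isLittleO (hx : Tendsto x l atTop)
    (h : s =o[l] fun n => Real.log (x n)) (c : ℝ) :
    Tendsto (fun n => Real.exp (c * s n) / x n) l (𝓝 0) := by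
  have hlog : Tendsto (fun n => Real.log (x n)) l atTop := Real.tendsto_log_atTop.comp hx
  have hexponent : Tendsto (fun n => c * s n - Real.log (x n)) l atBot := by
    refine tendsto_atBot_mono' l ?_
      (tendsto_neg_atTop_atBot.comp (hlog.atTop_mul_const (one_half_pos (α := ℝ))))
    filter_upwards [(h.const_mul_left c).bound one_half_pos, hlog.eventually_ge_atTop 0]
      with n hn hlogn
    rw [Real.norm_of_nonneg hlogn] at hn
    simp only [Function.comp_apply]
    linarith [Real.le_norm_self (c * s n)]
  refine (Real.tendsto_exp_atBot.comp hexponent).congr' ?_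
  filter_upwards [hx.eventually_gt_atTop 0] with n hn
  rw [Function.comp_apply, Real.exp_sub, Real.exp_log hn]

end Asymptotics

section Rates

/-- The rate `√(d / τ * log (k (d - k)))` at which the `k`-subsets of `{1, …, d}` become
distinguishable with budget `τ`. -/
noncomputable def kSetsRate (d k : ℕ) (τ : ℝ≥0) : ℝ :=
  √((d : ℝ) / τ * Real.log ((k : ℝ) * ((d : ℝ) - k)))

variable {d k : ℕ → ℕ} {τ : ℕ → ℝ≥0} {μ : ℕ → ℝ}

theorem tendsto_natCast_comp_atTop (hd : Tendsto d atTop atTop) :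
    Tendsto (fun n => (d n : ℝ)) atTop atTop :=
  tendsto_natCast_atTop_atTop.comp hd

theorem isTheta_log_mul_sub (hd : Tendsto d atTop atTop) (hk : ∀ n, 1 ≤ k n)
    (hkd : ∀ n, k n < d n) :
    (fun n => Real.log ((k n : ℝ) * ((d n : ℝ) - k n))) =Θ[atTop] fun n => Real.log (d n) := by
  have hbounds : ∀ᶠ n in atTop, 0 ≤ Real.log (d n) ∧
      Real.log (d n) ≤ 2 * Real.log ((k n : ℝ) * ((d n : ℝ) - k n)) ∧
      Real.log ((k n : ℝ) * ((d n : ℝ) - k n)) ≤ 2 * Real.log (d n) := by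
    filter_upwards [hd.eventually_ge_atTop 3] with n hn
    have hd3 : (3 : ℝ) ≤ d n := by exact_mod_cast hn
    have hk1 : (1 : ℝ) ≤ k n := by exact_mod_cast hk n
    have hkd1 : (k n : ℝ) + 1 ≤ d n := by exact_mod_cast hkd n
    have hlower : (d n : ℝ) - 1 ≤ k n * (d n - k n) := by nlinarith
    have hupper : (k n : ℝ) * (d n - k n) ≤ d n ^ 2 := by nlinarith
    refine ⟨Real.log_nonneg (by linarith), ?_, ?_⟩
    · calc Real.log (d n) ≤ Real.log (((k n : ℝ) * (d n - k n)) ^ 2) :=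
            Real.log_le_log (by linarith) (by nlinarith)
        _ = _ := by rw [Real.log_pow, Nat.cast_ofNat]
    · calc Real.log ((k n : ℝ) * (d n - k n)) ≤ Real.log ((d n : ℝ) ^ 2) :=
            Real.log_le_log (by linarith) hupper
        _ = _ := by rw [Real.log_pow, Nat.cast_ofNat]
  constructor <;> refine .of_bound 2 ?_ <;> filter_upwards [hbounds] with n ⟨h0, hlower, hupper⟩ <;>
    rwa [Real.norm_of_nonneg (by linarith), Real.norm_of_nonneg (by linarith)]

theorem isTheta_div_mul_kSetsRate_sq (hd : Tendsto d atTop atTop) (hk : ∀ n, 1 ≤ k n)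
    (hkd : ∀ n, k n < d n) (hτ : ∀ n, 0 < τ n) :
    (fun n => (τ n : ℝ) / d n * kSetsRate (d n) (k n) (τ n) ^ 2) =Θ[atTop]
      fun n => Real.log (d n) := by
  have hsq (n : ℕ) : (τ n : ℝ) / d n * kSetsRate (d n) (k n) (τ n) ^ 2 =
      Real.log ((k n : ℝ) * ((d n : ℝ) - k n)) := by
    have hτ0 : (0 : ℝ) < τ n := by exact_mod_cast hτ n
    have hk1 : (1 : ℝ) ≤ k n := by exact_mod_cast hk n
    have hkd1 : (k n : ℝ) + 1 ≤ d n := by exact_mod_cast hkd n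
    have hlog : 0 ≤ Real.log ((k n : ℝ) * ((d n : ℝ) - k n)) := Real.log_nonneg (by nlinarith)
    have hd0 : (0 : ℝ) < d n := by linarith
    rw [kSetsRate, Real.sq_sqrt (by positivity)]
    field_simp
  simpa only [hsq] using isTheta_log_mul_sub hd hk hkd

theorem isLittleO_log_of_kSetsRate_isLittleO (hd : Tendsto d atTop atTop) (hk : ∀ n, 1 ≤ k n)
    (hkd : ∀ n, k n < d n) (hτ : ∀ n, 0 < τ n)
    (h : (fun n => kSetsRate (d n) (k n) (τ n)) =o[atTop] μ) :
    (fun n => Real.log (d n)) =o[atTop] fun n => (τ n : ℝ) / d n * μ n ^ 2 :=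
  (isTheta_div_mul_kSetsRate_sq hd hk hkd hτ).symm.trans_isLittleO
    ((isBigO_refl _ _).mul_isLittleO (h.pow two_pos))

theorem isLittleO_log_of_isLittleO_kSetsRate (hd : Tendsto d atTop atTop) (hk : ∀ n, 1 ≤ k n)
    (hkd : ∀ n, k n < d n) (hτ : ∀ n, 0 < τ n)
    (h : μ =o[atTop] fun n => kSetsRate (d n) (k n) (τ n)) :
    (fun n => (τ n : ℝ) / d n * μ n ^ 2) =o[atTop] fun n => Real.log (d n) :=
  ((isBigO_refl _ _).mul_isLittleO (h.pow two_pos)).trans_isTheta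
    (isTheta_div_mul_kSetsRate_sq hd hk hkd hτ)

theorem tendsto_maxRisk_uniformDesign (hd : Tendsto d atTop atTop) (hk : ∀ n, 1 ≤ k n)
    (hkd : ∀ n, k n < d n) (hτ : ∀ n, 0 < τ n)
    (h : (fun n => kSetsRate (d n) (k n) (τ n)) =o[atTop] μ)
    {T : ∀ n, (Fin (d n) → ℝ) → KSubset (d n) (k n)}
    (hT : ∀ n, IsDesignMLE (kSets (d n) (k n) (μ n)) (uniformDesign (d n) (τ n)) (T n)) :
    Tendsto (fun n => maxRisk (fun S =>
      designLaw (kSets (d n) (k n) (μ n) S) (uniformDesign (d n) (τ n))) (T n)) atTop (𝓝 0) := by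
  have hunion := tendsto_mul_exp_neg_of_isLittleO (tendsto_natCast_comp_atTop hd)
    (fun n => by positivity) (isLittleO_log_of_kSetsRate_isLittleO hd hk hkd hτ h)
    (c := 1 / 8) (by norm_num)
  have hbound := ENNReal.tendsto_ofReal
    (((Real.continuous_exp.tendsto 0).comp hunion).sub_const 1)
  rw [Real.exp_zero, sub_self, ENNReal.ofReal_zero] at hbound
  refine tendsto_of_tendsto_of_tendsto_of_le_of_le tendsto_const_nhds hbound
    (fun _ => zero_le) fun n => ?_
  simpa only [Function.comp_apply, one_div_mul_eq_div, neg_div] using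
    maxRisk_uniformDesign_le (hT n)

theorem tendsto_one_sub_rpow (hd : Tendsto d atTop atTop) (hk : ∀ n, 1 ≤ k n)
    (hkd : ∀ n, k n < d n) (hτ : ∀ n, 0 < τ n)
    (h : μ =o[atTop] fun n => kSetsRate (d n) (k n) (τ n)) :
    Tendsto (fun n => 1 - ENNReal.ofReal
      (4 * (Real.exp (4 * (τ n / d n * μ n ^ 2)) / d n)) ^ (1 / 2 : ℝ)) atTop (𝓝 1) := by
  have hratio := tendsto_exp_div_of_isLittleO (tendsto_natCast_comp_atTop hd)
    (isLittleO_log_of_isLittleO_kSetsRate hd hk hkd hτ h) 4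
  have hrpow := ((ENNReal.continuous_rpow_const (y := 1 / 2)).tendsto _).comp
    (ENNReal.tendsto_ofReal (hratio.const_mul 4))
  simpa using ENNReal.Tendsto.sub tendsto_const_nhds hrpow (.inl ENNReal.one_ne_top)

theorem isMinimaxRate_kSetsRate_of_le {R : ℕ → ℝ → ℝ≥0∞} (hd : Tendsto d atTop atTop)
    (hk : ∀ n, 1 ≤ k n) (hkd : ∀ n, k n < d n) (hτ : ∀ n, 0 < τ n)
    (hlower : ∀ n μ, budgetMinimaxRisk (kSets (d n) (k n) μ) (τ n) ≤ R n μ)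
    (hupper : ∀ n μ, R n μ ≤ lawMinimaxRisk fun S =>
      designLaw (kSets (d n) (k n) μ S) (uniformDesign (d n) (τ n))) :
    IsMinimaxRate R fun n => kSetsRate (d n) (k n) (τ n) := by
  have (n : ℕ) : Nonempty (KSubset (d n) (k n)) := nonempty_kSubset (hkd n).le
  refine fun μ => ⟨fun h => ?_, fun h => ?_⟩
  · choose T hT using fun n =>
      exists_isDesignMLE (kSets (d n) (k n) (μ n)) (uniformDesign (d n) (τ n))
    exact tendsto_of_tendsto_of_tendsto_of_le_of_le tendsto_const_nhds
      (tendsto_maxRisk_uniformDesign hd hk hkd hτ h hT) (fun _ => zero_le)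
      fun n => (hupper n (μ n)).trans (iInf₂_le _ (hT n).1)
  · exact tendsto_of_tendsto_of_tendsto_of_le_of_le (tendsto_one_sub_rpow hd hk hkd hτ h)
      tendsto_const_nhds
      (fun n => (one_sub_rpow_le_budgetMinimaxRisk_kSets (hk n) (hkd n) (μ n) (τ n)).trans
        (hlower n (μ n)))
      fun n => (hupper n (μ n)).trans (lawMinimaxRisk_le_one _)

theorem isMinimaxRate_budgetMinimaxRisk (hd : Tendsto d atTop atTop) (hk : ∀ n, 1 ≤ k n)
    (hkd : ∀ n, k n < d n) (hτ : ∀ n, 0 < τ n) :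
    IsMinimaxRate (fun n μ => budgetMinimaxRisk (kSets (d n) (k n) μ) (τ n))
      fun n => kSetsRate (d n) (k n) (τ n) :=
  isMinimaxRate_kSetsRate_of_le hd hk hkd hτ (fun _ _ => le_rfl)
    fun _ _ => iInf₂_le (uniformDesign _ _) (sum_uniformDesign_le _ _)

-- The isotropic model is uniform sampling with budget `d`.
theorem isMinimaxRate_minimaxRisk (hd : Tendsto d atTop atTop) (hk : ∀ n, 1 ≤ k n)
    (hkd : ∀ n, k n < d n) :
    IsMinimaxRate (fun n μ => minimaxRisk (kSets (d n) (k n) μ))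
      fun n => √(Real.log ((k n : ℝ) * ((d n : ℝ) - k n))) := by
  have hd0 (n : ℕ) : 0 < d n := pos_of_gt (hkd n)
  have hunif (n : ℕ) : uniformDesign (d n) (d n) = 1 :=
    funext fun _ => div_self (Nat.cast_ne_zero.2 (hd0 n).ne')
  have hmodel (n : ℕ) (μ : ℝ) : minimaxRisk (kSets (d n) (k n) μ) = lawMinimaxRisk fun S =>
      designLaw (kSets (d n) (k n) μ S) (uniformDesign (d n) (d n)) := by
    simp only [minimaxRisk, isoLaw_eq_designLaw_one, hunif]
  have hrate (n : ℕ) : kSetsRate (d n) (k n) (d n) =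
      √(Real.log ((k n : ℝ) * ((d n : ℝ) - k n))) := by
    rw [kSetsRate, NNReal.coe_natCast, div_self (Nat.cast_ne_zero.2 (hd0 n).ne'), one_mul]
  simpa only [hrate] using isMinimaxRate_kSetsRate_of_le hd hk hkd
    (fun n => Nat.cast_pos.2 (hd0 n))
    (fun n μ => (hmodel n μ).symm ▸ iInf₂_le (uniformDesign _ _) (sum_uniformDesign_le _ _))
    fun n μ => (hmodel n μ).le

end Rates

end NormalMeans

theorem corollary1 :
    -- the minimax rates, isotropic and with budget `τ`
    (∀ d k : ℕ → ℕ, Tendsto d atTop atTop → (∀ n, 1 ≤ k n) → (∀ n, k n < d n) →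
      NormalMeans.IsMinimaxRate
        (fun n μ => NormalMeans.minimaxRisk (NormalMeans.kSets (d n) (k n) μ))
        (fun n => √(Real.log ((k n : ℝ) * ((d n : ℝ) - (k n : ℝ))))) ∧
      ∀ τ : ℕ → ℝ≥0, (∀ n, 0 < τ n) →
        NormalMeans.IsMinimaxRate
          (fun n μ => NormalMeans.budgetMinimaxRisk (NormalMeans.kSets (d n) (k n) μ) (τ n))
          (fun n => √((d n : ℝ) / (τ n : ℝ) *
            Real.log ((k n : ℝ) * ((d n : ℝ) - (k n : ℝ))))) ∧
        -- uniform sampling, with the MLE, attains the rate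
        (∀ (μ : ℕ → ℝ) (T : ∀ n, (Fin (d n) → ℝ) → NormalMeans.KSubset (d n) (k n)),
          (fun n => √((d n : ℝ) / (τ n : ℝ) *
            Real.log ((k n : ℝ) * ((d n : ℝ) - (k n : ℝ))))) =o[atTop] μ →
          (∀ n, NormalMeans.IsDesignMLE (NormalMeans.kSets (d n) (k n) (μ n))
            (NormalMeans.uniformDesign (d n) (τ n)) (T n)) →
          Tendsto (fun n => NormalMeans.maxRisk
            (fun S => NormalMeans.designLaw (NormalMeans.kSets (d n) (k n) (μ n) S)
              (NormalMeans.uniformDesign (d n) (τ n))) (T n)) atTop (𝓝 0))) ∧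
    -- uniform sampling minimizes the SEDF under the budget constraint
    (∀ (d k : ℕ) (μ α : ℝ) (τ : ℝ≥0), k ≤ d → 0 < α →
      ∑ i, NormalMeans.uniformDesign d τ i ≤ τ ∧
      ∀ B : Fin d → ℝ≥0, ∑ i, B i ≤ τ →
        NormalMeans.sedf (NormalMeans.kSets d k μ) α (NormalMeans.uniformDesign d τ) ≤
          NormalMeans.sedf (NormalMeans.kSets d k μ) α B) ∧
    -- maximum likelihood estimators exist, for every sampling strategy
    (∀ (d k : ℕ) (μ : ℝ), k ≤ d →
      (∃ T, NormalMeans.IsMLE (NormalMeans.kSets d k μ) T) ∧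
      ∀ B : Fin d → ℝ≥0, ∃ T, NormalMeans.IsDesignMLE (NormalMeans.kSets d k μ) B T) ∧
    -- in the isotropic case the MLE is exactly minimax optimal
    (∀ (d k : ℕ) (μ : ℝ), k ≤ d → μ ≠ 0 →
      ∀ T, NormalMeans.IsMLE (NormalMeans.kSets d k μ) T →
        NormalMeans.maxRisk (fun S => NormalMeans.isoLaw (NormalMeans.kSets d k μ S)) T =
          NormalMeans.minimaxRisk (NormalMeans.kSets d k μ)) := by
  refine ⟨fun d k hd hk hkd => ⟨NormalMeans.isMinimaxRate_minimaxRisk hd hk hkd, fun τ hτ =>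
    ⟨NormalMeans.isMinimaxRate_budgetMinimaxRisk hd hk hkd hτ, fun μ T h hT =>
      NormalMeans.tendsto_maxRisk_uniformDesign hd hk hkd hτ h hT⟩⟩, ?_, ?_, ?_⟩
  · exact fun d k μ α τ _ hα => ⟨NormalMeans.sum_uniformDesign_le d τ,
      fun B hB => NormalMeans.sedf_kSets_uniformDesign_le d k μ hα.le hB⟩
  · intro d k μ hkd
    have : Nonempty (NormalMeans.KSubset d k) := NormalMeans.nonempty_kSubset hkd
    exact ⟨NormalMeans.exists_isMLE _, NormalMeans.exists_isDesignMLE _⟩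
  · exact fun d k μ _ hμ T hT => NormalMeans.maxRisk_eq_minimaxRisk_of_isMLE hμ hT
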